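/- **Setting.** Let $\kappa\ge 1$. Let $\mathbf{X}_{\rm data}=[\mathbf x_1,\dots,\mathbf x_n]\in\mathbb{R}^{p\times n}$, $\mathbf{X}_{\rm aux}=[\mathbf x_1',\dots,\mathbf x_n']\in\mathbb{R}^{q\times n}$, labels $y_1,\dots,y_n\in\{0,1,\dots,\kappa\}$, a tuning parameter $\xi\ge 0$, and a score function $h:\mathbb{R}\to[0,\infty)$ be given. For $\mathbf a\in\mathbb{R}^\kappa$ put $g_0(\mathbf a)=\frac{1}{1+\sum_{c=1}^\kappa h(a_c)}$ and $g_j(\mathbf a)=\frac{h(a_j)}{1+\sum_{c=1}^\kappa h(a_c)}$ for $1\le j\le\kappa$. For $\mathbf Z=(\mathbf W,\mathbf H,\boldsymbol\beta,\boldsymbol\Gamma)\in\mathbb{R}^{p\times r}\times\mathbb{R}^{r\times n}\times\mathbb{R}^{r\times\kappa}\times\mathbb{R}^{q\times\kappa}$, with $\mathbf h_i$ the $i$-th column of $\mathbf H$, the supervised dictionary learning (SDL) objective is $$L(\mathbf Z)=-\sum_{i=1}^n\sum_{j=0}^\kappa \mathbf 1(y_i=j)\log g_j(\mathbf a_i(\mathbf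 Z))+\xi\|\mathbf X_{\rm data}-\mathbf W\mathbf H\|_F^2,$$ where either $\mathbf a_i(\mathbf Z)=\boldsymbol\beta^T\mathbf h_i+\boldsymbol\Gamma^T\mathbf x_i'$ (feature-based model) or $\mathbf a_i(\mathbf Z)=\boldsymbol\beta^T\mathbf W^T\mathbf x_i+\boldsymbol\Gamma^T\mathbf x_i'$ (filter-based model). The parameter space carries the Frobenius inner product and norm $\|\mathbf Z\|_F^2=\|\mathbf W\|_F^2+\|\mathbf H\|_F^2+\|\boldsymbol\beta\|_F^2+\|\boldsymbol\Gamma\|_F^2$. Let $\mathcal C^{\rm dict},\mathcal C^{\rm code},\mathcal C^{\rm beta},\mathcal C^{\rm aux}$ be convex compact subsets of the four matrix spaces and $\boldsymbol\Theta=\mathcal C^{\rm dict}\times\mathcal C^{\rm code}\times\mathcal C^{\rm beta}\times\mathcal C^{\rm aux}$. Let $M\in(0,\infty)$ be such that $\|\mathbf a_i(\mathbf Z)\|\le M$ for all $\mathbf Z\in\boldsymbol\Theta$ and all $i$. Assume that (A4) $h$ is twice continuously differentiable and there are $\gamma,\alpha^-,\alpha^+\in(0,\infty)$ such that for all $\mathbf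 a\in\mathbb{R}^\kappa$ with $\|\mathbf a\|<M$ and all $s\in\{1,\dots,n\}$ one has $|\dot h_j(y_s,\mathbf a)|\le\gamma$ for $1\le j\le\kappa$ and all eigenvalues of the symmetric matrix $\ddot{\mathbf H}(y_s,\mathbf a)\in\mathbb{R}^{\kappa\times\kappa}$ lie in $[\alpha^-,\alpha^+]$, where $$\dot h_j(y,\mathbf a)=\frac{h'(a_j)}{1+\sum_c h(a_c)}-\mathbf 1(y=j)\frac{h'(a_j)}{h(a_j)},$$ $$\ddot{\mathbf H}(y,\mathbf a)_{ij}=\frac{h''(a_j)\mathbf 1(i=j)}{1+\sum_c h(a_c)}-\frac{h'(a_i)h'(a_j)}{(1+\sum_c h(a_c))^2}-\mathbf 1(y=i=j)\left(\frac{h''(a_j)}{h(a_j)}-\frac{h'(a_j)^2}{h(a_j)^2}\right).$$ **Algorithm (block coordinate descent with diminishing radius).** Let the radii $r_k>0$, $k\ge1$, satisfy $\sum_{k}r_k=\infty$ and $\sum_k r_k^2<\infty$. From $\mathbf Z_0\in\boldsymbol\Theta$, iterate for $k=1,2,\dots$, choosing any minimizer in each step: $$\mathbf W_k\in\operatorname*{argmin}_{\mathbf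 W\in\mathcal C^{\rm dict},\ \|\mathbf W-\mathbf W_{k-1}\|_F\le r_k}L(\mathbf W,\mathbf H_{k-1},\boldsymbol\beta_{k-1},\boldsymbol\Gamma_{k-1}),\qquad \boldsymbol\beta_k\in\operatorname*{argmin}_{\boldsymbol\beta\in\mathcal C^{\rm beta},\ \|\boldsymbol\beta-\boldsymbol\beta_{k-1}\|_F\le r_k}L(\mathbf W_k,\mathbf H_{k-1},\boldsymbol\beta,\boldsymbol\Gamma_{k-1}),$$ $$\boldsymbol\Gamma_k\in\operatorname*{argmin}_{\boldsymbol\Gamma\in\mathcal C^{\rm aux},\ \|\boldsymbol\Gamma-\boldsymbol\Gamma_{k-1}\|_F\le r_k}L(\mathbf W_k,\mathbf H_{k-1},\boldsymbol\beta_k,\boldsymbol\Gamma),\qquad \mathbf H_k\in\operatorname*{argmin}_{\mathbf H\in\mathcal C^{\rm code},\ \|\mathbf H-\mathbf H_{k-1}\|_F\le r_k}L(\mathbf W_k,\mathbf H,\boldsymbol\beta_k,\boldsymbol\Gamma_k),$$ and let $\mathbf Z_k=(\mathbf W_k,\mathbf H_k,\boldsymbol\beta_k,\boldsymbol\Gamma_k)$.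 **Optimality.** For $\mathbf Z^*\in\boldsymbol\Theta$ let $$\operatorname{gap}(\mathbf Z^*)=-\inf_{\mathbf Z\in\boldsymbol\Theta}\left\langle\nabla L(\mathbf Z^*),\frac{\mathbf Z-\mathbf Z^*}{\|\mathbf Z-\mathbf Z^*\|_F}\right\rangle,$$ the quotient being $0$ for $\mathbf Z=\mathbf Z^*$. The point $\mathbf Z^*$ is stationary if $\langle\nabla L(\mathbf Z^*),\mathbf Z-\mathbf Z^*\rangle\ge0$ for all $\mathbf Z\in\boldsymbol\Theta$, and $\varepsilon$-stationary if $\operatorname{gap}(\mathbf Z^*)\le\sqrt\varepsilon$. **Theorem.** For either model, $L$ is differentiable at every point of $\boldsymbol\Theta$, and for every initial point $\mathbf Z_0\in\boldsymbol\Theta$ the following hold. (i) $\mathbf Z_t$ converges to the set of stationary points of $L$ over $\boldsymbol\Theta$, i.e. its distance to that set tends to $0$ as $t\to\infty$. (ii) There is a constant $C>0$ such that $\min_{1\le k\le T}\operatorname{gap}(\mathbf Z_k)\le C\left(\sum_{k=1}^T r_k\right)^{-1}$ for every $T\ge1$. (iii) If $r_k=1/(\sqrt k\log k)$ for all sufficiently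 large $k$, then there is a constant $C>0$ such that for every $\varepsilon\in(0,1/2]$ some iterate $\mathbf Z_k$ with $1\le k\le C\,\varepsilon^{-1}(\log\varepsilon^{-1})^2$ is $\varepsilon$-stationary. The constants in (ii) and (iii) do not depend on $\mathbf Z_0$ or on the choice of the minimizers. -/

import Mathlib

open scoped Matrix Topology

noncomputable section

namespace SDL

/-- Real `m × n` matrices, as a Euclidean space: the norm is the Frobenius norm and the inner
product is the Frobenius (trace) inner product. -/
abbrev FMat (m n : ℕ) : Type := EuclideanSpace ℝ (Fin m × Fin n)

/-- The underlying matrix. -/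
def FMat.mat {m n : ℕ} (A : FMat m n) : Matrix (Fin m) (Fin n) ℝ :=
  Matrix.of fun i j => A (i, j)

/-- A matrix as an element of the Frobenius space. -/
def FMat.ofMat {m n : ℕ} (A : Matrix (Fin m) (Fin n) ℝ) : FMat m n :=
  WithLp.toLp 2 fun ij => A ij.1 ij.2

/-- The space of parameters `Z = (W, H, β, Γ)` with
`W ∈ ℝ^{p×r}`, `H ∈ ℝ^{r×n}`, `β ∈ ℝ^{r×κ}`, `Γ ∈ ℝ^{q×κ}`, normed by
`‖Z‖² = ‖W‖² + ‖H‖² + ‖β‖² + ‖Γ‖²` (Frobenius norms). -/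
abbrev Param (p q r n κ : ℕ) : Type :=
  WithLp 2 (FMat p r × WithLp 2 (FMat r n × WithLp 2 (FMat r κ × FMat q κ)))

section Blocks

variable {p q r n κ : ℕ}

/-- The parameter with the four given blocks. -/
def Param.mk (W : FMat p r) (H : FMat r n) (B : FMat r κ) (G : FMat q κ) : Param p q r n κ :=
  WithLp.toLp 2 (W, WithLp.toLp 2 (H, WithLp.toLp 2 (B, G)))

/-- The dictionary block `W`. -/
def Param.W (Z : Param p q r n κ) : FMat p r := WithLp.fst Z

/-- The code block `H`. -/
def Param.H (Z : Param p q r n κ) : FMat r n := WithLp.fst (WithLp.snd Z)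

/-- The regression block `β`. -/
def Param.B (Z : Param p q r n κ) : FMat r κ := WithLp.fst (WithLp.snd (WithLp.snd Z))

/-- The auxiliary block `Γ`. -/
def Param.G (Z : Param p q r n κ) : FMat q κ := WithLp.snd (WithLp.snd (WithLp.snd Z))

/-- The product constraint set `Θ = C^dict × C^code × C^beta × C^aux`. -/
def constraintSet (Cdict : Set (FMat p r)) (Ccode : Set (FMat r n)) (Cbeta : Set (FMat r κ))
    (Caux : Set (FMat q κ)) : Set (Param p q r n κ) :=
  {Z | Param.W Z ∈ Cdict ∧ Param.H Z ∈ Ccode ∧ Param.B Z ∈ Cbeta ∧ Param.G Z ∈ Caux}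

end Blocks

/-! ### The prediction model and the training objective -/

/-- The predictive probabilities `g_0(a), …, g_κ(a)` with score function `h` and activation `a`:
`g_0(a) = 1 / (1 + ∑ h(a_c))` and `g_j(a) = h(a_j) / (1 + ∑ h(a_c))`.
The activation coordinate `c : Fin κ` belongs to the class label `c.succ : Fin (κ + 1)`. -/
def predProb {κ : ℕ} (h : ℝ → ℝ) (a : EuclideanSpace ℝ (Fin κ)) : Fin (κ + 1) → ℝ :=
  Fin.cons (1 / (1 + ∑ c, h (a c))) (fun j => h (a j) / (1 + ∑ c, h (a c)))

/-- The two types of supervised dictionary learning. -/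
inductive Model : Type
  | featureBased : Model
  | filterBased : Model

/-- The activation of the `i`-th data point: `βᵀ h_i + Γᵀ x'_i` (feature-based) or
`βᵀ Wᵀ x_i + Γᵀ x'_i` (filter-based), where `x_i`, `x'_i`, `h_i` are the `i`-th columns of
`Xdata`, `Xaux`, `H`. -/
def activation {p q r n κ : ℕ} (model : Model) (Xdata : Matrix (Fin p) (Fin n) ℝ)
    (Xaux : Matrix (Fin q) (Fin n) ℝ) (Z : Param p q r n κ) (i : Fin n) :
    EuclideanSpace ℝ (Fin κ) :=
  match model with
  | Model.featureBased =>
      WithLp.toLp 2 ((Param.B Z).matᵀ *ᵥ (fun l => (Param.H Z).mat l i)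
        + (Param.G Z).matᵀ *ᵥ (fun l => Xaux l i))
  | Model.filterBased =>
      WithLp.toLp 2 ((Param.B Z).matᵀ *ᵥ ((Param.W Z).matᵀ *ᵥ (fun l => Xdata l i))
        + (Param.G Z).matᵀ *ᵥ (fun l => Xaux l i))

/-- The training objective
`L(Z) = -∑_i ∑_j 1(y_i = j) log g_j(a_i) + ξ ‖Xdata - W H‖_F²`. -/
def loss {p q r n κ : ℕ} (model : Model) (h : ℝ → ℝ) (Xdata : Matrix (Fin p) (Fin n) ℝ)
    (Xaux : Matrix (Fin q) (Fin n) ℝ) (y : Fin n → Fin (κ + 1)) (ξ : ℝ)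
    (Z : Param p q r n κ) : ℝ :=
  (-∑ i, ∑ j, (if y i = j then (1 : ℝ) else 0) *
      Real.log (predProb h (activation model Xdata Xaux Z i) j))
    + ξ * ‖FMat.ofMat (Xdata - (Param.W Z).mat * (Param.H Z).mat)‖ ^ 2

/-! ### The assumptions on activation and score function -/

/-- Bounded activation: over `Θ` all activations have Euclidean norm at most `M ∈ (0, ∞)`. -/
def BoundedActivation {p q r n κ : ℕ} (model : Model) (Xdata : Matrix (Fin p) (Fin n) ℝ)
    (Xaux : Matrix (Fin q) (Fin n) ℝ) (Θ : Set (Param p q r n κ)) (M : ℝ) : Prop :=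
  0 < M ∧ ∀ Z ∈ Θ, ∀ i, ‖activation model Xdata Xaux Z i‖ ≤ M

/-- The vector `ḣ(y, a)`. -/
def hDot {κ : ℕ} (h : ℝ → ℝ) (y : Fin (κ + 1)) (a : EuclideanSpace ℝ (Fin κ)) (j : Fin κ) : ℝ :=
  deriv h (a j) / (1 + ∑ c, h (a c))
    - (if y = j.succ then (1 : ℝ) else 0) * (deriv h (a j) / h (a j))

/-- The observed information matrix `Ḧ(y, a)`. -/
def HDDot {κ : ℕ} (h : ℝ → ℝ) (y : Fin (κ + 1)) (a : EuclideanSpace ℝ (Fin κ)) :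
    Matrix (Fin κ) (Fin κ) ℝ :=
  Matrix.of fun i j =>
    (deriv (deriv h) (a j) * (if i = j then (1 : ℝ) else 0) / (1 + ∑ c, h (a c))
        - deriv h (a i) * deriv h (a j) / (1 + ∑ c, h (a c)) ^ 2)
      - (if y = j.succ ∧ i = j then (1 : ℝ) else 0) *
          (deriv (deriv h) (a j) / h (a j) - (deriv h (a j)) ^ 2 / (h (a j)) ^ 2)

/-- Bounded stiffness and bounded eigenvalues of the observed information, for activations of
norm less than `M`: the score function is nonnegative and twice continuously differentiable, the
entries of `ḣ(y_s, a)` are bounded by `γ`, and the eigenvalues of the symmetric matrices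
`Ḧ(y_s, a)` lie in `[αmin, αmax]`, with `γ, αmin, αmax ∈ (0, ∞)`. -/
def BoundedInformation {n κ : ℕ} (h : ℝ → ℝ) (y : Fin n → Fin (κ + 1)) (M : ℝ) : Prop :=
  (∀ t, 0 ≤ h t) ∧ ContDiff ℝ 2 h ∧
    ∃ γ αmin αmax : ℝ, 0 < γ ∧ 0 < αmin ∧ 0 < αmax ∧
      ∀ a : EuclideanSpace ℝ (Fin κ), ‖a‖ < M → ∀ s : Fin n,
        (∀ j, |hDot h (y s) a j| ≤ γ) ∧ spectrum ℝ (HDDot h (y s) a) ⊆ Set.Icc αmin αmax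

/-! ### First-order optimality over a constraint set -/

section Stationarity

variable {E : Type*} [NormedAddCommGroup E] [InnerProductSpace ℝ E] [CompleteSpace E]

/-- `x` is a stationary point of `f` over `Θ`. -/
def IsStationaryPoint (f : E → ℝ) (Θ : Set E) (x : E) : Prop :=
  x ∈ Θ ∧ ∀ y ∈ Θ, 0 ≤ inner ℝ (gradient f x) (y - x)

/-- The first-order optimality measure `-inf_{y ∈ Θ} ⟨∇f(x), (y - x) / ‖y - x‖⟩`; the quotient is
`0` for `y = x`. The infimum is over a set bounded below by `-‖∇f(x)‖`. -/
def optimalityMeasure (f : E → ℝ) (Θ : Set E) (x : E) : ℝ :=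
  -sInf ((fun y => inner ℝ (gradient f x) (‖y - x‖⁻¹ • (y - x))) '' Θ)

/-- `x` is an `ε`-stationary point of `f` over `Θ`. -/
def IsEpsStationaryPoint (f : E → ℝ) (Θ : Set E) (ε : ℝ) (x : E) : Prop :=
  x ∈ Θ ∧ optimalityMeasure f Θ x ≤ √ε

end Stationarity

/-! ### Block coordinate descent with diminishing radius -/

/-- `x` is a minimizer of `f` over `{y ∈ C : ‖y - c‖ ≤ ρ}`. -/
def IsArgminInBall {E : Type*} [NormedAddCommGroup E] (f : E → ℝ) (C : Set E) (c : E) (ρ : ℝ)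
    (x : E) : Prop :=
  (x ∈ C ∧ ‖x - c‖ ≤ ρ) ∧ ∀ y ∈ C, ‖y - c‖ ≤ ρ → f x ≤ f y

/-- `Z 0, Z 1, …` are iterates of block coordinate descent with radii `ρ 1, ρ 2, …`, started
in the constraint set, with the blocks updated in the order `W`, `β`, `Γ`, `H`. -/
structure IsBCDDR {p q r n κ : ℕ} (L : Param p q r n κ → ℝ) (Cdict : Set (FMat p r))
    (Ccode : Set (FMat r n)) (Cbeta : Set (FMat r κ)) (Caux : Set (FMat q κ)) (ρ : ℕ → ℝ)
    (Z : ℕ → Param p q r n κ) : Prop where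
  init : Z 0 ∈ constraintSet Cdict Ccode Cbeta Caux
  update_W : ∀ k, IsArgminInBall
    (fun W => L (Param.mk W (Param.H (Z k)) (Param.B (Z k)) (Param.G (Z k))))
    Cdict (Param.W (Z k)) (ρ (k + 1)) (Param.W (Z (k + 1)))
  update_B : ∀ k, IsArgminInBall
    (fun B => L (Param.mk (Param.W (Z (k + 1))) (Param.H (Z k)) B (Param.G (Z k))))
    Cbeta (Param.B (Z k)) (ρ (k + 1)) (Param.B (Z (k + 1)))
  update_G : ∀ k, IsArgminInBall
    (fun G => L (Param.mk (Param.W (Z (k + 1))) (Param.H (Z k)) (Param.B (Z (k + 1))) G))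
    Caux (Param.G (Z k)) (ρ (k + 1)) (Param.G (Z (k + 1)))
  update_H : ∀ k, IsArgminInBall
    (fun H => L (Param.mk (Param.W (Z (k + 1))) H (Param.B (Z (k + 1))) (Param.G (Z (k + 1)))))
    Ccode (Param.H (Z k)) (ρ (k + 1)) (Param.H (Z (k + 1)))

end SDL

end

/-! The proof separates smoothness of the objective from a descent argument that uses nothing else
about it.

Smoothness: the only danger is `log h` where `h` vanishes. If class `j` occurs, the bound on `hDot`
at the activation `t e_j` forces `|h'| ≤ K h` on `(-M, M)`, so by a Grönwall argument one zero of
`h` in `[-M, M]` makes `h` vanish on the whole interval. Then `HDDot` at `0` is the zero matrix,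
against the positive lower eigenvalue bound. Hence `h > 0` on `[-M, M]`
(`BoundedInformation.score_pos`), and the objective is C² on `Θ`.

Descent: on the compact convex `Θ` the derivative is Lipschitz. If `x` minimizes over a convex set
within distance `r` of `c`, first-order optimality tested at a suitable convex combination of `y`
and `c`, with a Taylor estimate, gives `r * (-L'(x)(y - x)) ≤ ‖y - x‖ * (L c - L x + K r²)`
(`argmin_ball_stationarity`). No convexity of `L` in a block is needed, and it does not matter
whether the ball constraint is active. Adding the four blocks (`sweep_stationarity`) bounds `ρ`
times the optimality measure by a quantity `D` whose sum over all sweeps is finite, since the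
descents telescope and `∑ ρ²` converges. This yields the rate.

For convergence, near a nonstationary point the same estimate gives `ρ = O(D)`. The path length
there is summable, so an iterate arriving late and close enough would never leave, and `∑ ρ` would
converge (`eventually_dist_ge_of_descent`). Thus all cluster points are stationary. -/

open scoped Matrix Topology

noncomputable section

namespace SDL

/-! ### Lipschitz derivatives and approximate stationarity of a minimizer in a ball. -/

section Abstract

variable {E : Type*} [NormedAddCommGroup E] [NormedSpace ℝ E]

/-- On a compact convex set of points of twice continuous differentiability the derivative is
Lipschitz. -/
theorem exists_fderiv_lipschitz {L : E → ℝ} {Θ : Set E} (hc : IsCompact Θ) (hconv : Convex ℝ Θ)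
    (hL : ∀ x ∈ Θ, ContDiffAt ℝ 2 L x) :
    ∃ K : ℝ, 0 ≤ K ∧ ∀ x ∈ Θ, ∀ y ∈ Θ, ‖fderiv ℝ L y - fderiv ℝ L x‖ ≤ K * ‖y - x‖ := by
  have h1 : ∀ x ∈ Θ, ContDiffAt ℝ 1 (fderiv ℝ L) x := fun x hx =>
    (hL x hx).fderiv_right (by norm_num)
  have h2 : ContinuousOn (fun x => ‖fderiv ℝ (fderiv ℝ L) x‖) Θ := fun x hx =>
    (((h1 x hx).fderiv_right (m := 0) (by norm_num)).continuousAt).norm.continuousWithinAt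
  obtain ⟨K, hK⟩ := hc.bddAbove_image h2
  refine ⟨max K 0, le_max_right _ _, fun x hx y hy => ?_⟩
  exact hconv.norm_image_sub_le_of_norm_fderiv_le
    (fun z hz => (h1 z hz).differentiableAt (by norm_num))
    (fun z hz => (hK (Set.mem_image_of_mem _ hz)).trans (le_max_left _ _)) hx hy

/-- First-order Taylor estimate for a function with Lipschitz derivative. -/
theorem taylor_bound {L : E → ℝ} {Θ : Set E} {K : ℝ} (hK0 : 0 ≤ K) (hconv : Convex ℝ Θ)
    (hd : ∀ x ∈ Θ, DifferentiableAt ℝ L x)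
    (hK : ∀ x ∈ Θ, ∀ y ∈ Θ, ‖fderiv ℝ L y - fderiv ℝ L x‖ ≤ K * ‖y - x‖)
    {x c : E} (hx : x ∈ Θ) (hc : c ∈ Θ) :
    |L c - L x - fderiv ℝ L x (c - x)| ≤ K * ‖c - x‖ ^ 2 := by
  have hseg : segment ℝ x c ⊆ Θ := hconv.segment_subset hx hc
  -- Mean value inequality for `L` minus its linearization at `x`. It loses the usual factor `1/2`,
  -- which affects only constants.
  have := (convex_segment x c).norm_image_sub_le_of_norm_fderiv_le' (𝕜 := ℝ) (f := L)
    (φ := fderiv ℝ L x) (C := K * ‖c - x‖)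
    (fun z hz => hd z (hseg hz))
    (fun z hz => (hK x hx z (hseg hz)).trans <| by
      gcongr
      obtain ⟨a, b, ha, hb, hab, rfl⟩ := hz
      have : a • x + b • c - x = b • (c - x) := by
        rw [← eq_sub_iff_add_eq] at hab; subst hab; module
      rw [this, norm_smul, Real.norm_of_nonneg hb]
      exact mul_le_of_le_one_left (norm_nonneg _) (by linarith))
    (left_mem_segment ℝ x c) (right_mem_segment ℝ x c)
  rw [Real.norm_eq_abs] at this
  linarith [this, sq (‖c - x‖)]

/-- A minimizer over a convex set has nonnegative directional derivatives into the set. -/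
theorem fderiv_nonneg_of_minOn {L : E → ℝ} {S : Set E} (hS : Convex ℝ S) {x z : E}
    (hd : DifferentiableAt ℝ L x) (hx : x ∈ S) (hz : z ∈ S) (hmin : ∀ w ∈ S, L x ≤ L w) :
    0 ≤ fderiv ℝ L x (z - x) := by
  have hm : IsLocalMinOn L S x := Filter.eventually_of_mem self_mem_nhdsWithin hmin
  exact hm.hasFDerivWithinAt_nonneg hd.hasFDerivAt.hasFDerivWithinAt
    (sub_mem_posTangentConeAt_of_segment_subset (hS.segment_subset hx hz))

/-- A minimizer `x` over the part of a convex set `S` within distance `r` of `c ∈ S` is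
approximately stationary over `S`, with an error controlled by the descent `L c - L x`. -/
theorem argmin_ball_stationarity {L : E → ℝ} {Θ S : Set E} {K r : ℝ} (hK0 : 0 ≤ K)
    (hconv : Convex ℝ Θ) (hd : ∀ x ∈ Θ, DifferentiableAt ℝ L x)
    (hK : ∀ x ∈ Θ, ∀ y ∈ Θ, ‖fderiv ℝ L y - fderiv ℝ L x‖ ≤ K * ‖y - x‖)
    (hS : Convex ℝ S) (hSΘ : S ⊆ Θ) (hr : 0 < r) {x c : E} (hx : x ∈ S) (hc : c ∈ S)
    (hxc : ‖x - c‖ ≤ r) (hmin : ∀ z ∈ S, ‖z - c‖ ≤ r → L x ≤ L z) {y : E} (hy : y ∈ S) :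
    r * (-fderiv ℝ L x (y - x)) ≤ ‖y - x‖ * (L c - L x + K * r ^ 2) := by
  have htay := taylor_bound hK0 hconv hd hK (hSΘ hx) (hSΘ hc)
  have hT : fderiv ℝ L x (c - x) ≤ L c - L x + K * r ^ 2 := by
    have h1 : K * ‖c - x‖ ^ 2 ≤ K * r ^ 2 := by
      rw [norm_sub_rev]; gcongr
    linarith [(abs_le.1 htay).1]
  rcases eq_or_ne y x with rfl | hyx
  · simp
  have hpos : 0 < ‖y - x‖ := norm_pos_iff.2 (sub_ne_zero.2 hyx)
  set d := ‖y - x‖ with hdd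
  -- the test point `x + t (y - x) + u (c - x)` with `t = r / (r + d)` and `u = d / (r + d)`
  set z : E := x + (r / (r + d)) • (y - x) + (d / (r + d)) • (c - x) with hzdef
  have hrd : 0 < r + d := by positivity
  have hsum : r / (r + d) + d / (r + d) = 1 := by field_simp
  -- The weights sum to `1`, so the `x` terms cancel and `z` lies in `S`. They also make `z - c`
  -- equal to `r / (r + d)` times `(y - x) + (x - c)`, whose norm is at most `d + r`, so `z` lies in
  -- the ball.
  have hz_eq : z = (r / (r + d)) • y + (d / (r + d)) • c := by
    have : r / (r + d) = 1 - d / (r + d) := by linarith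
    rw [hzdef, this]; module
  have hzS : z ∈ S := by
    rw [hz_eq]; exact hS hy hc (by positivity) (by positivity) hsum
  have hzc : ‖z - c‖ ≤ r := by
    have e : z - c = (r / (r + d)) • (y - x) + (r / (r + d)) • (x - c) := by
      have : d / (r + d) = 1 - r / (r + d) := by linarith
      rw [hz_eq, this]; module
    rw [e]
    refine (norm_add_le _ _).trans ?_
    rw [norm_smul, norm_smul, Real.norm_of_nonneg (by positivity), ← hdd]
    calc r / (r + d) * d + r / (r + d) * ‖x - c‖ ≤ r / (r + d) * d + r / (r + d) * r := by gcongr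
      _ = r := by field_simp; ring
  have hcv : Convex ℝ (S ∩ Metric.closedBall c r) := hS.inter (convex_closedBall c r)
  have h0 := fderiv_nonneg_of_minOn (L := L) hcv (hd x (hSΘ hx))
    ⟨hx, by simpa [dist_eq_norm] using hxc⟩ ⟨hzS, by simpa [dist_eq_norm] using hzc⟩
    (fun w hw => hmin w hw.1 (by simpa [dist_eq_norm] using hw.2))
  have e : z - x = (r / (r + d)) • (y - x) + (d / (r + d)) • (c - x) := by
    rw [hzdef]; abel
  rw [e, map_add, map_smul, map_smul, smul_eq_mul, smul_eq_mul] at h0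
  have h1 : 0 ≤ r * fderiv ℝ L x (y - x) + d * fderiv ℝ L x (c - x) := by
    have := mul_nonneg hrd.le h0
    have e2 : (r + d) * (r / (r + d) * fderiv ℝ L x (y - x) + d / (r + d) * fderiv ℝ L x (c - x))
      = r * fderiv ℝ L x (y - x) + d * fderiv ℝ L x (c - x) := by field_simp
    linarith
  have := mul_le_mul_of_nonneg_left hT hpos.le
  linarith

end Abstract

/-! ### Block structure of the parameter space and the estimate for one sweep. -/

section Step

/-- Stationarity estimate for the update of one block `w`, embedded as `b + ι w`. -/
theorem block_stationarity {E F : Type*} [NormedAddCommGroup E] [NormedSpace ℝ E]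
    [NormedAddCommGroup F] [NormedSpace ℝ F] {L : E → ℝ} {Θ : Set E} {K r : ℝ} (hK0 : 0 ≤ K)
    (hconv : Convex ℝ Θ) (hd : ∀ x ∈ Θ, DifferentiableAt ℝ L x)
    (hK : ∀ x ∈ Θ, ∀ y ∈ Θ, ‖fderiv ℝ L y - fderiv ℝ L x‖ ≤ K * ‖y - x‖)
    (ι : F →ₗᵢ[ℝ] E) (b : E) {C : Set F} (hC : Convex ℝ C) (hCΘ : ∀ w ∈ C, b + ι w ∈ Θ)
    (hr : 0 < r) {x c : F} (hc : c ∈ C) (hx : IsArgminInBall (fun w => L (b + ι w)) C c r x)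
    {y : F} (hy : y ∈ C) :
    r * (-fderiv ℝ L (b + ι x) (ι (y - x))) ≤
      ‖y - x‖ * (L (b + ι c) - L (b + ι x) + K * r ^ 2) := by
  have hnorm : ∀ u v : F, ‖(b + ι u) - (b + ι v)‖ = ‖u - v‖ := fun u v => by
    rw [add_sub_add_left_eq_sub, ← map_sub, ι.norm_map]
  have hS : Convex ℝ ((fun w => b + ι w) '' C) := by
    have := (hC.linear_image ι.toLinearMap).translate b
    rwa [Set.image_image] at this
  have key := argmin_ball_stationarity (S := (fun w => b + ι w) '' C) hK0 hconv hd hK hS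
    (by rintro _ ⟨w, hw, rfl⟩; exact hCΘ w hw) hr (Set.mem_image_of_mem _ hx.1.1)
    (Set.mem_image_of_mem _ hc) (by simpa only [hnorm] using hx.1.2)
    (by
      rintro _ ⟨w, hw, rfl⟩ hwc
      exact hx.2 w hw (by simpa only [hnorm] using hwc))
    (Set.mem_image_of_mem _ hy)
  rw [hnorm] at key
  simpa only [add_sub_add_left_eq_sub, ← map_sub] using key

variable {p q r n κ : ℕ}

/-- The inclusion of the dictionary block. -/
def inclW : FMat p r →ₗᵢ[ℝ] Param p q r n κ where
  toFun W := Param.mk W 0 0 0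
  map_add' A B := by simp [Param.mk, ← WithLp.toLp_add]
  map_smul' a A := by simp [Param.mk, ← WithLp.toLp_smul]
  norm_map' A := by simp [Param.mk, WithLp.prod_norm_eq_of_L2]

/-- The inclusion of the code block. -/
def inclH : FMat r n →ₗᵢ[ℝ] Param p q r n κ where
  toFun H := Param.mk 0 H 0 0
  map_add' A B := by simp [Param.mk, ← WithLp.toLp_add]
  map_smul' a A := by simp [Param.mk, ← WithLp.toLp_smul]
  norm_map' A := by simp [Param.mk, WithLp.prod_norm_eq_of_L2]

/-- The inclusion of the regression block. -/
def inclB : FMat r κ →ₗᵢ[ℝ] Param p q r n κ where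
  toFun B := Param.mk 0 0 B 0
  map_add' A B := by simp [Param.mk, ← WithLp.toLp_add]
  map_smul' a A := by simp [Param.mk, ← WithLp.toLp_smul]
  norm_map' A := by simp [Param.mk]

/-- The inclusion of the auxiliary block. -/
def inclG : FMat q κ →ₗᵢ[ℝ] Param p q r n κ where
  toFun G := Param.mk 0 0 0 G
  map_add' A B := by simp [Param.mk, ← WithLp.toLp_add]
  map_smul' a A := by simp [Param.mk, ← WithLp.toLp_smul]
  norm_map' A := by simp [Param.mk]

theorem mk_add_inclW (W : FMat p r) (H : FMat r n) (B : FMat r κ) (G : FMat q κ) :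
    Param.mk 0 H B G + inclW W = Param.mk W H B G := by
  simp [inclW, Param.mk, ← WithLp.toLp_add]

theorem mk_add_inclH (W : FMat p r) (H : FMat r n) (B : FMat r κ) (G : FMat q κ) :
    Param.mk W 0 B G + inclH H = Param.mk W H B G := by
  simp [inclH, Param.mk, ← WithLp.toLp_add]

theorem mk_add_inclB (W : FMat p r) (H : FMat r n) (B : FMat r κ) (G : FMat q κ) :
    Param.mk W H 0 G + inclB B = Param.mk W H B G := by
  simp [inclB, Param.mk, ← WithLp.toLp_add]

theorem mk_add_inclG (W : FMat p r) (H : FMat r n) (B : FMat r κ) (G : FMat q κ) :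
    Param.mk W H B 0 + inclG G = Param.mk W H B G := by
  simp [inclG, Param.mk, ← WithLp.toLp_add]

/-- Lets a derivative along an arbitrary displacement be split into the four block derivatives, each
controlled by its own block update. -/
theorem Param.sub_eq (Y Z : Param p q r n κ) :
    Y - Z = inclW (Y.W - Z.W) + inclH (Y.H - Z.H) + inclB (Y.B - Z.B) + inclG (Y.G - Z.G) := by
  simp [inclW, inclH, inclB, inclG, Param.mk, ← WithLp.toLp_add]
  rfl

theorem Param.norm_W_sub_le (Y Z : Param p q r n κ) : ‖Y.W - Z.W‖ ≤ ‖Y - Z‖ :=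
  WithLp.norm_fst_le _ (Y - Z)

theorem Param.norm_H_sub_le (Y Z : Param p q r n κ) : ‖Y.H - Z.H‖ ≤ ‖Y - Z‖ :=
  (WithLp.norm_fst_le _ (Y - Z).snd).trans (WithLp.norm_snd_le _ (Y - Z))

theorem Param.norm_B_sub_le (Y Z : Param p q r n κ) : ‖Y.B - Z.B‖ ≤ ‖Y - Z‖ :=
  (WithLp.norm_fst_le _ (Y - Z).snd.snd).trans
    ((WithLp.norm_snd_le _ (Y - Z).snd).trans (WithLp.norm_snd_le _ (Y - Z)))

theorem Param.norm_G_sub_le (Y Z : Param p q r n κ) : ‖Y.G - Z.G‖ ≤ ‖Y - Z‖ :=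
  (WithLp.norm_snd_le _ (Y - Z).snd.snd).trans
    ((WithLp.norm_snd_le _ (Y - Z).snd).trans (WithLp.norm_snd_le _ (Y - Z)))

theorem norm_mk_sub_le (W W' : FMat p r) (H H' : FMat r n) (B B' : FMat r κ) (G G' : FMat q κ) :
    ‖Param.mk W H B G - Param.mk W' H' B' G'‖ ≤
      ‖W - W'‖ + ‖H - H'‖ + ‖B - B'‖ + ‖G - G'‖ := by
  rw [Param.sub_eq]
  refine (norm_add_le _ _).trans (add_le_add (norm_add₃_le.trans ?_) ?_)
  · simp only [LinearIsometry.norm_map]; exact le_rfl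
  · simp only [LinearIsometry.norm_map]; exact le_rfl

theorem convex_constraintSet {Cdict : Set (FMat p r)} {Ccode : Set (FMat r n)}
    {Cbeta : Set (FMat r κ)} {Caux : Set (FMat q κ)} (h1 : Convex ℝ Cdict) (h2 : Convex ℝ Ccode)
    (h3 : Convex ℝ Cbeta) (h4 : Convex ℝ Caux) :
    Convex ℝ (constraintSet Cdict Ccode Cbeta Caux) := fun _ hX _ hY _ _ ha hb hab =>
  ⟨h1 hX.1 hY.1 ha hb hab, h2 hX.2.1 hY.2.1 ha hb hab, h3 hX.2.2.1 hY.2.2.1 ha hb hab,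
    h4 hX.2.2.2 hY.2.2.2 ha hb hab⟩

theorem isCompact_constraintSet {Cdict : Set (FMat p r)} {Ccode : Set (FMat r n)}
    {Cbeta : Set (FMat r κ)} {Caux : Set (FMat q κ)} (h1 : IsCompact Cdict) (h2 : IsCompact Ccode)
    (h3 : IsCompact Cbeta) (h4 : IsCompact Caux) :
    IsCompact (constraintSet Cdict Ccode Cbeta Caux) := by
  have := (h1.prod (h2.prod (h3.prod h4))).image
    (f := fun x : FMat p r × FMat r n × FMat r κ × FMat q κ =>
      inclW (p := p) (q := q) (r := r) (n := n) (κ := κ) x.1 + inclH x.2.1 + inclB x.2.2.1 +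
        inclG x.2.2.2)
    (((((inclW.continuous.comp continuous_fst)).add
      (inclH.continuous.comp (continuous_fst.comp continuous_snd))).add
      (inclB.continuous.comp (continuous_fst.comp (continuous_snd.comp continuous_snd)))).add
      (inclG.continuous.comp (continuous_snd.comp (continuous_snd.comp continuous_snd))))
  refine this.of_isClosed_subset ?_ ?_
  · exact ((h1.isClosed.preimage (WithLp.continuous_fst ..))).inter
      ((h2.isClosed.preimage ((WithLp.continuous_fst ..).comp (WithLp.continuous_snd ..))).inter
      ((h3.isClosed.preimage ((WithLp.continuous_fst ..).comp ((WithLp.continuous_snd ..).comp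
        (WithLp.continuous_snd ..)))).inter
      (h4.isClosed.preimage ((WithLp.continuous_snd ..).comp ((WithLp.continuous_snd ..).comp
        (WithLp.continuous_snd ..))))))
  · intro Z hZ
    refine ⟨(Z.W, Z.H, Z.B, Z.G), ⟨hZ.1, hZ.2.1, hZ.2.2.1, hZ.2.2.2⟩, ?_⟩
    have := Param.sub_eq Z 0
    have w0 : Param.W (0 : Param p q r n κ) = 0 := rfl
    have h0 : Param.H (0 : Param p q r n κ) = 0 := rfl
    have b0 : Param.B (0 : Param p q r n κ) = 0 := rfl
    have g0 : Param.G (0 : Param p q r n κ) = 0 := rfl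
    rw [w0, h0, b0, g0, sub_zero, sub_zero, sub_zero, sub_zero, sub_zero] at this
    exact this.symm

/-- One sweep of block coordinate descent in balls of radius `ρ`: the objective decreases, the
iterate moves by at most `4 ρ`, and the new iterate is approximately stationary. -/
theorem sweep_stationarity {L : Param p q r n κ → ℝ} {Cdict : Set (FMat p r)}
    {Ccode : Set (FMat r n)} {Cbeta : Set (FMat r κ)} {Caux : Set (FMat q κ)}
    (h1 : Convex ℝ Cdict) (h2 : Convex ℝ Ccode) (h3 : Convex ℝ Cbeta) (h4 : Convex ℝ Caux)
    {Θ : Set (Param p q r n κ)} (hΘ : Θ = constraintSet Cdict Ccode Cbeta Caux) {K ρ : ℝ}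
    (hK0 : 0 ≤ K) (hd : ∀ x ∈ Θ, DifferentiableAt ℝ L x)
    (hK : ∀ x ∈ Θ, ∀ y ∈ Θ, ‖fderiv ℝ L y - fderiv ℝ L x‖ ≤ K * ‖y - x‖)
    (hρ : 0 < ρ) {Z Z' : Param p q r n κ} (hZ : Z ∈ Θ)
    (hW : IsArgminInBall (fun W => L (Param.mk W Z.H Z.B Z.G)) Cdict Z.W ρ Z'.W)
    (hB : IsArgminInBall (fun B => L (Param.mk Z'.W Z.H B Z.G)) Cbeta Z.B ρ Z'.B)
    (hG : IsArgminInBall (fun G => L (Param.mk Z'.W Z.H Z'.B G)) Caux Z.G ρ Z'.G)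
    (hH : IsArgminInBall (fun H => L (Param.mk Z'.W H Z'.B Z'.G)) Ccode Z.H ρ Z'.H) :
    Z' ∈ Θ ∧ ‖Z' - Z‖ ≤ 4 * ρ ∧ L Z' ≤ L Z ∧
      ∀ Y ∈ Θ, ρ * (-fderiv ℝ L Z' (Y - Z')) ≤ ‖Y - Z'‖ * (L Z - L Z' + 16 * K * ρ ^ 2) := by
  have hconv : Convex ℝ Θ := hΘ ▸ convex_constraintSet h1 h2 h3 h4
  subst hΘ
  obtain ⟨zW, zH, zB, zG⟩ := hZ
  have mW := hW.1.1
  have mB := hB.1.1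
  have mG := hG.1.1
  have mH := hH.1.1
  have hZ' : Z' ∈ constraintSet Cdict Ccode Cbeta Caux := ⟨mW, mH, mB, mG⟩
  -- The intermediate points of the sweep. Each block estimate has its derivative at the point
  -- reached just after that block's update.
  set V1 := Param.mk Z'.W Z.H Z.B Z.G with hV1
  set V2 := Param.mk Z'.W Z.H Z'.B Z.G with hV2
  set V3 := Param.mk Z'.W Z.H Z'.B Z'.G with hV3
  have mV1 : V1 ∈ constraintSet Cdict Ccode Cbeta Caux := ⟨mW, zH, zB, zG⟩
  have mV2 : V2 ∈ constraintSet Cdict Ccode Cbeta Caux := ⟨mW, zH, mB, zG⟩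
  have mV3 : V3 ∈ constraintSet Cdict Ccode Cbeta Caux := ⟨mW, zH, mB, mG⟩
  have eZ : Param.mk Z.W Z.H Z.B Z.G = Z := rfl
  have eZ' : Param.mk Z'.W Z'.H Z'.B Z'.G = Z' := rfl
  have dW := hW.2 _ zW (by simpa using hρ.le)
  have dB := hB.2 _ zB (by simpa using hρ.le)
  have dG := hG.2 _ zG (by simpa using hρ.le)
  have dH := hH.2 _ zH (by simpa using hρ.le)
  simp only [eZ, eZ', ← hV1, ← hV2, ← hV3] at dW dB dG dH
  -- At most three blocks remain to be moved after the first update; the same bound is used for all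
  -- intermediate points.
  have n1 : ‖Z' - V1‖ ≤ 3 * ρ := by
    have := norm_mk_sub_le Z'.W Z'.W Z'.H Z.H Z'.B Z.B Z'.G Z.G
    rw [sub_self, norm_zero, eZ', ← hV1] at this
    linarith [hB.1.2, hG.1.2, hH.1.2]
  have n2 : ‖Z' - V2‖ ≤ 3 * ρ := by
    have := norm_mk_sub_le Z'.W Z'.W Z'.H Z.H Z'.B Z'.B Z'.G Z.G
    rw [sub_self, sub_self, norm_zero, norm_zero, eZ', ← hV2] at this
    linarith [hG.1.2, hH.1.2]
  have n3 : ‖Z' - V3‖ ≤ 3 * ρ := by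
    have := norm_mk_sub_le Z'.W Z'.W Z'.H Z.H Z'.B Z'.B Z'.G Z'.G
    rw [sub_self, sub_self, sub_self, norm_zero, norm_zero, norm_zero, eZ', ← hV3] at this
    linarith [hH.1.2]
  have n0 : ‖Z' - Z‖ ≤ 4 * ρ := by
    have := norm_mk_sub_le Z'.W Z.W Z'.H Z.H Z'.B Z.B Z'.G Z.G
    rw [eZ', eZ] at this
    linarith [hW.1.2, hB.1.2, hG.1.2, hH.1.2]
  refine ⟨hZ', n0, by linarith, fun Y hY => ?_⟩
  have kW := block_stationarity hK0 hconv hd hK inclW (Param.mk 0 Z.H Z.B Z.G) h1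
    (fun w hw => by rw [mk_add_inclW]; exact ⟨hw, zH, zB, zG⟩) hρ zW
    (by simpa only [mk_add_inclW] using hW) hY.1
  have kB := block_stationarity hK0 hconv hd hK inclB (Param.mk Z'.W Z.H 0 Z.G) h3
    (fun w hw => by rw [mk_add_inclB]; exact ⟨mW, zH, hw, zG⟩) hρ zB
    (by simpa only [mk_add_inclB] using hB) hY.2.2.1
  have kG := block_stationarity hK0 hconv hd hK inclG (Param.mk Z'.W Z.H Z'.B 0) h4
    (fun w hw => by rw [mk_add_inclG]; exact ⟨mW, zH, mB, hw⟩) hρ zG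
    (by simpa only [mk_add_inclG] using hG) hY.2.2.2
  have kH := block_stationarity hK0 hconv hd hK inclH (Param.mk Z'.W 0 Z'.B Z'.G) h2
    (fun w hw => by rw [mk_add_inclH]; exact ⟨mW, hw, mB, mG⟩) hρ zH
    (by simpa only [mk_add_inclH] using hH) hY.2.1
  simp only [mk_add_inclW, mk_add_inclB, mk_add_inclG, mk_add_inclH, eZ, eZ', ← hV1, ← hV2,
    ← hV3] at kW kB kG kH
  -- passing from the derivative at an intermediate point to the derivative at `Z'`
  have aux : ∀ V ∈ constraintSet Cdict Ccode Cbeta Caux, ‖Z' - V‖ ≤ 3 * ρ →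
      ∀ e : Param p q r n κ, ∀ s D : ℝ, ‖e‖ ≤ s → s ≤ ‖Y - Z'‖ → 0 ≤ D →
        ρ * (-fderiv ℝ L V e) ≤ s * (D + K * ρ ^ 2) →
        ρ * (-fderiv ℝ L Z' e) ≤ ‖Y - Z'‖ * (D + 4 * K * ρ ^ 2) := by
    intro V hV hn e s D he hs hD hk
    have hle : -fderiv ℝ L Z' e ≤ -fderiv ℝ L V e + 3 * K * ρ * s := by
      have h5 : |(fderiv ℝ L Z' - fderiv ℝ L V) e| ≤ K * (3 * ρ) * s := by
        rw [← Real.norm_eq_abs]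
        refine (ContinuousLinearMap.le_opNorm _ _).trans ?_
        have := hK V hV Z' hZ'
        gcongr
        exact this.trans (by gcongr)
      have := (abs_le.1 h5).1
      rw [sub_apply] at this
      linarith
    -- `K ρ²` from the block estimate plus `3 K ρ²` from transporting the derivative makes `4 K ρ²`;
    -- four blocks give the `16 K ρ²` of the conclusion.
    calc ρ * (-fderiv ℝ L Z' e) ≤ ρ * (-fderiv ℝ L V e + 3 * K * ρ * s) := by gcongr
      _ ≤ s * (D + 4 * K * ρ ^ 2) := by nlinarith
      _ ≤ ‖Y - Z'‖ * (D + 4 * K * ρ ^ 2) := by gcongr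
  have lW := aux V1 mV1 n1 _ _ _ (inclW.norm_map _).le (Param.norm_W_sub_le Y Z') (by linarith) kW
  have lB := aux V2 mV2 n2 _ _ _ (inclB.norm_map _).le (Param.norm_B_sub_le Y Z') (by linarith) kB
  have lG := aux V3 mV3 n3 _ _ _ (inclG.norm_map _).le (Param.norm_G_sub_le Y Z') (by linarith) kG
  have lH := aux Z' hZ' (by simpa using hρ.le) _ _ _ (inclH.norm_map _).le
    (Param.norm_H_sub_le Y Z') (by linarith) kH
  have e : fderiv ℝ L Z' (Y - Z') = fderiv ℝ L Z' (inclW (Y.W - Z'.W)) +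
      fderiv ℝ L Z' (inclH (Y.H - Z'.H)) + fderiv ℝ L Z' (inclB (Y.B - Z'.B)) +
      fderiv ℝ L Z' (inclG (Y.G - Z'.G)) := by
    rw [← map_add, ← map_add, ← map_add, ← Param.sub_eq]
  -- The four block descents telescope along `Z, V1, V2, V3, Z'`.
  rw [e]
  linarith

end Step

/-! ### Positivity of the score function and smoothness of the objective. -/

section Smoothness

variable {p q r n κ : ℕ}

/-- Under the bounded information assumption the score function of an occurring label satisfies
a logarithmic derivative bound. -/
theorem BoundedInformation.abs_deriv_le {h : ℝ → ℝ} {y : Fin n → Fin (κ + 1)} {M : ℝ}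
    (hinfo : BoundedInformation h y M) (hM : 0 < M) {s : Fin n} {j : Fin κ}
    (hs : y s = j.succ) : ∃ K : ℝ, ∀ t ∈ Set.Ioo (-M) M, |deriv h t| ≤ K * h t := by
  obtain ⟨hn, hC, γ, αmin, αmax, hγ, -, -, H⟩ := hinfo
  obtain ⟨B, hB⟩ := isCompact_Icc.bddAbove_image (hC.continuous.continuousOn (s := Set.Icc (-M) M))
  have hB' : ∀ t ∈ Set.Icc (-M) M, h t ≤ B := fun t ht => hB (Set.mem_image_of_mem _ ht)
  refine ⟨γ * (1 + κ * B), fun t ht => ?_⟩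
  -- At a zero of `h` the quotient `h' / h` is `0` by convention and the bound on `hDot` is of no
  -- help, but the zero is a minimum of the nonnegative `h`.
  rcases (hn t).eq_or_lt with h0 | hpos
  · have : IsLocalMin h t := Filter.Eventually.of_forall fun u => h0 ▸ hn u
    rw [this.deriv_eq_zero, ← h0]; simp
  set a : EuclideanSpace ℝ (Fin κ) := EuclideanSpace.single j t with ha
  have haj : a j = t := by simp [ha]
  have hnorm : ‖a‖ < M := by
    rw [ha, PiLp.norm_single, Real.norm_eq_abs]; exact abs_lt.2 ht
  set S := ∑ c, h (a c) with hS
  have hS1 : h t ≤ S := by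
    have := Finset.single_le_sum (f := fun c => h (a c)) (fun c _ => hn _) (Finset.mem_univ j)
    simpa only [haj] using this
  have hS2 : S ≤ κ * B := by
    have : ∀ c ∈ Finset.univ, h (a c) ≤ B := fun c _ => by
      apply hB'
      by_cases hcj : c = j
      · rw [hcj, haj]; exact ⟨ht.1.le, ht.2.le⟩
      · have : a c = 0 := by simp [ha, hcj]
        rw [this]; exact ⟨by linarith, hM.le⟩
    simpa using Finset.sum_le_card_nsmul _ _ _ this
  have h1 := (H a hnorm s).1 j
  rw [hDot, hs, haj, ← hS, if_pos rfl, one_mul] at h1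
  have hS0 : 0 < 1 + S := by linarith
  -- The two terms of `hDot` cannot cancel: the factor `1 + S - h t` is at least `1`, because `h t`
  -- is one of the summands of `S`.
  have e : deriv h t / (1 + S) - deriv h t / h t =
      -(deriv h t * ((1 + S - h t) / (h t * (1 + S)))) := by
    field_simp; ring
  have hq : 0 ≤ (1 + S - h t) / (h t * (1 + S)) := div_nonneg (by linarith) (by positivity)
  rw [e, abs_neg, abs_mul, abs_of_nonneg hq,
    mul_div_assoc', div_le_iff₀ (by positivity)] at h1
  calc |deriv h t| ≤ |deriv h t| * (1 + S - h t) :=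
        le_mul_of_one_le_right (abs_nonneg _) (by linarith)
    _ ≤ γ * (h t * (1 + S)) := h1
    _ ≤ γ * (h t * (1 + κ * B)) := by gcongr
    _ = _ := by ring

/-- A nonnegative function with `|h'| ≤ K h` on an interval vanishes identically once it
vanishes somewhere. -/
theorem eqOn_zero_of_abs_deriv_le {h : ℝ → ℝ} {M K : ℝ} (hn : ∀ t, 0 ≤ h t)
    (hd : Differentiable ℝ h) (hK : ∀ t ∈ Set.Ioo (-M) M, |deriv h t| ≤ K * h t) {t₀ : ℝ}
    (ht₀ : t₀ ∈ Set.Icc (-M) M) (h0 : h t₀ = 0) : ∀ t ∈ Set.Icc (-M) M, h t = 0 := by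
  have hder : ∀ c t : ℝ, HasDerivAt (fun u => h u * Real.exp (c * u))
      ((deriv h t + c * h t) * Real.exp (c * t)) t := fun c t => by
    have h1 : HasDerivAt (fun u => Real.exp (c * u)) (Real.exp (c * t) * (c * 1)) t :=
      ((hasDerivAt_id t).const_mul c).exp
    exact ((hd t).hasDerivAt.mul h1).congr_deriv (by ring)
  -- Grönwall with integrating factors: the increasing product carries the zero to the left, the
  -- decreasing one below carries it to the right, both up to the endpoints.
  have hmono : MonotoneOn (fun u => h u * Real.exp (K * u)) (Set.Icc (-M) M) := by
    refine monotoneOn_of_deriv_nonneg (convex_Icc _ _)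
      (fun t _ => (hder K t).continuousAt.continuousWithinAt)
      (fun t _ => (hder K t).differentiableAt.differentiableWithinAt) fun t ht => ?_
    rw [interior_Icc] at ht
    rw [(hder K t).deriv]
    exact mul_nonneg (by linarith [neg_le_of_abs_le (hK t ht)]) (Real.exp_pos _).le
  have hanti : AntitoneOn (fun u => h u * Real.exp (-K * u)) (Set.Icc (-M) M) := by
    refine antitoneOn_of_deriv_nonpos (convex_Icc _ _)
      (fun t _ => (hder (-K) t).continuousAt.continuousWithinAt)
      (fun t _ => (hder (-K) t).differentiableAt.differentiableWithinAt) fun t ht => ?_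
    rw [interior_Icc] at ht
    rw [(hder (-K) t).deriv]
    exact mul_nonpos_of_nonpos_of_nonneg (by linarith [le_of_abs_le (hK t ht)])
      (Real.exp_pos _).le
  intro t ht
  refine le_antisymm ?_ (hn t)
  rcases le_total t t₀ with hle | hle
  · have := hmono ht ht₀ hle
    simp only [h0, zero_mul] at this
    exact nonpos_of_mul_nonpos_left this (Real.exp_pos _)
  · have := hanti ht₀ ht hle
    simp only [h0, zero_mul] at this
    exact nonpos_of_mul_nonpos_left this (Real.exp_pos _)

/-- The score function is positive on the range of activations of every occurring label. -/
theorem BoundedInformation.score_pos {h : ℝ → ℝ} {y : Fin n → Fin (κ + 1)} {M : ℝ}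
    (hinfo : BoundedInformation h y M) (hM : 0 < M) {s : Fin n} {j : Fin κ}
    (hs : y s = j.succ) {t : ℝ} (ht : |t| ≤ M) : 0 < h t := by
  obtain ⟨K, hK⟩ := hinfo.abs_deriv_le hM hs
  obtain ⟨hn, hC, γ, αmin, αmax, -, hα, -, H⟩ := hinfo
  refine (hn t).lt_of_ne fun h0 => ?_
  have hz := eqOn_zero_of_abs_deriv_le hn (hC.differentiable (by norm_num)) hK (abs_le.1 ht) h0.symm
  -- The activation `0` is admissible since `0 < M`. There `h`, `h'` and `h''` vanish, so the
  -- information matrix is zero and has eigenvalue `0`; its index type is nonempty because it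
  -- contains `j`.
  have hev : h =ᶠ[𝓝 0] fun _ => (0 : ℝ) := by
    filter_upwards [Icc_mem_nhds (neg_lt_zero.2 hM) hM] with u hu using hz u hu
  have hd0 : deriv h 0 = 0 := by rw [hev.deriv_eq]; simp
  have hdd0 : deriv (deriv h) 0 = 0 := by
    rw [hev.deriv.deriv_eq]; simp
  have hmat : HDDot h (y s) (0 : EuclideanSpace ℝ (Fin κ)) = 0 := by
    ext i k
    simp [HDDot, hd0, hdd0]
  have hspec := (H 0 (by simpa using hM) s).2
  have : Nonempty (Fin κ) := ⟨j⟩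
  rw [hmat, spectrum.zero_eq] at hspec
  exact absurd (hspec rfl).1 (not_le.2 hα)

theorem Param.contDiff_W {m : WithTop ℕ∞} (i : Fin p) (l : Fin r) :
    ContDiff ℝ m (fun Z : Param p q r n κ => Z.W (i, l)) :=
  ((EuclideanSpace.proj (i, l) : FMat p r →L[ℝ] ℝ).comp
    (WithLp.fstL 2 ℝ (FMat p r) (WithLp 2 (FMat r n × WithLp 2 (FMat r κ × FMat q κ))))).contDiff

theorem Param.contDiff_H {m : WithTop ℕ∞} (i : Fin r) (l : Fin n) :
    ContDiff ℝ m (fun Z : Param p q r n κ => Z.H (i, l)) :=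
  ((EuclideanSpace.proj (i, l) : FMat r n →L[ℝ] ℝ).comp
    ((WithLp.fstL 2 ℝ (FMat r n) (WithLp 2 (FMat r κ × FMat q κ))).comp
      (WithLp.sndL 2 ℝ (FMat p r) (WithLp 2 (FMat r n × WithLp 2 (FMat r κ × FMat q κ)))))).contDiff

theorem Param.contDiff_B {m : WithTop ℕ∞} (i : Fin r) (l : Fin κ) :
    ContDiff ℝ m (fun Z : Param p q r n κ => Z.B (i, l)) :=
  ((EuclideanSpace.proj (i, l) : FMat r κ →L[ℝ] ℝ).comp
    (((WithLp.fstL 2 ℝ (FMat r κ) (FMat q κ)).comp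
      (WithLp.sndL 2 ℝ (FMat r n) (WithLp 2 (FMat r κ × FMat q κ)))).comp
      (WithLp.sndL 2 ℝ (FMat p r) (WithLp 2 (FMat r n × WithLp 2 (FMat r κ × FMat q κ)))))).contDiff

theorem Param.contDiff_G {m : WithTop ℕ∞} (i : Fin q) (l : Fin κ) :
    ContDiff ℝ m (fun Z : Param p q r n κ => Z.G (i, l)) :=
  ((EuclideanSpace.proj (i, l) : FMat q κ →L[ℝ] ℝ).comp
    (((WithLp.sndL 2 ℝ (FMat r κ) (FMat q κ)).comp
      (WithLp.sndL 2 ℝ (FMat r n) (WithLp 2 (FMat r κ × FMat q κ)))).comp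
      (WithLp.sndL 2 ℝ (FMat p r) (WithLp 2 (FMat r n × WithLp 2 (FMat r κ × FMat q κ)))))).contDiff

theorem contDiff_activation {m : WithTop ℕ∞} (model : Model) (Xdata : Matrix (Fin p) (Fin n) ℝ)
    (Xaux : Matrix (Fin q) (Fin n) ℝ) (i : Fin n) (c : Fin κ) :
    ContDiff ℝ m (fun Z : Param p q r n κ => activation model Xdata Xaux Z i c) := by
  cases model
  · simp only [activation, Matrix.mulVec, dotProduct, FMat.mat, Matrix.transpose_apply,
      Matrix.of_apply, Pi.add_apply]
    exact (ContDiff.sum fun l _ => (Param.contDiff_B l c).mul (Param.contDiff_H l i)).add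
      (ContDiff.sum fun l _ => (Param.contDiff_G l c).mul contDiff_const)
  · simp only [activation, Matrix.mulVec, dotProduct, FMat.mat, Matrix.transpose_apply,
      Matrix.of_apply, Pi.add_apply]
    exact (ContDiff.sum fun l _ => (Param.contDiff_B l c).mul
      (ContDiff.sum fun l' _ => (Param.contDiff_W l' l).mul contDiff_const)).add
      (ContDiff.sum fun l _ => (Param.contDiff_G l c).mul contDiff_const)

/-- The objective is as smooth as the score function wherever the score function is positive at
the relevant activations. -/
theorem contDiffAt_loss {m : WithTop ℕ∞} (model : Model) {h : ℝ → ℝ} (hn : ∀ t, 0 ≤ h t)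
    (hC : ContDiff ℝ m h) (Xdata : Matrix (Fin p) (Fin n) ℝ) (Xaux : Matrix (Fin q) (Fin n) ℝ)
    (y : Fin n → Fin (κ + 1)) (ξ : ℝ) {Z : Param p q r n κ}
    (hpos : ∀ i j, y i = Fin.succ j → 0 < h (activation model Xdata Xaux Z i j)) :
    ContDiffAt ℝ m (loss model h Xdata Xaux y ξ) Z := by
  have hact : ∀ i c, ContDiffAt ℝ m
      (fun Z : Param p q r n κ => h (activation model Xdata Xaux Z i c)) Z := fun i c =>
    (hC.comp (contDiff_activation model Xdata Xaux i c)).contDiffAt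
  have hsum : ∀ i, ContDiffAt ℝ m
      (fun Z : Param p q r n κ => 1 + ∑ c, h (activation model Xdata Xaux Z i c)) Z := fun i =>
    contDiffAt_const.add (ContDiffAt.sum fun c _ => hact i c)
  have hsum_pos : ∀ i, 0 < 1 + ∑ c, h (activation model Xdata Xaux Z i c) := fun i => by
    have := Finset.sum_nonneg fun c (_ : c ∈ Finset.univ) => hn (activation model Xdata Xaux Z i c)
    linarith
  refine ContDiffAt.add (ContDiffAt.neg (ContDiffAt.sum fun i _ => ContDiffAt.sum fun j _ => ?_))
    (contDiffAt_const.mul ?_)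
  -- Only the observed class contributes. For class `0` the numerator is `1`, so positivity of `h`
  -- is needed only at observed nonzero labels.
  · by_cases hij : y i = j
    · simp only [if_pos hij, one_mul]
      cases j using Fin.cases with
      | zero =>
        simp only [predProb, Fin.cons_zero]
        exact (contDiffAt_const.div (hsum i) (hsum_pos i).ne').log
          (one_div_pos.2 (hsum_pos i)).ne'
      | succ c =>
        simp only [predProb, Fin.cons_succ]
        exact ((hact i c).div (hsum i) (hsum_pos i).ne').log
          (div_pos (hpos i c hij) (hsum_pos i)).ne'
    · simp only [if_neg hij, zero_mul]
      exact contDiffAt_const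
  · simp only [EuclideanSpace.norm_sq_eq, FMat.ofMat, Real.norm_eq_abs, sq_abs, Matrix.sub_apply,
      Matrix.mul_apply, FMat.mat, Matrix.of_apply]
    exact (ContDiff.sum fun ij _ => (contDiff_const.sub (ContDiff.sum fun l _ =>
      (Param.contDiff_W ij.1 l).mul (Param.contDiff_H l ij.2))).pow 2).contDiffAt

/-- Under the bounded activation and bounded information assumptions the objective is twice
continuously differentiable at every point of the constraint set. -/
theorem contDiffAt_loss_of_bounded {model : Model} {h : ℝ → ℝ} {Xdata : Matrix (Fin p) (Fin n) ℝ}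
    {Xaux : Matrix (Fin q) (Fin n) ℝ} {y : Fin n → Fin (κ + 1)} (ξ : ℝ)
    {Θ : Set (Param p q r n κ)} {M : ℝ} (hM : BoundedActivation model Xdata Xaux Θ M)
    (hinfo : BoundedInformation h y M) {Z : Param p q r n κ} (hZ : Z ∈ Θ) :
    ContDiffAt ℝ 2 (loss model h Xdata Xaux y ξ) Z :=
  contDiffAt_loss model hinfo.1 hinfo.2.1 Xdata Xaux y ξ fun i j hij =>
    -- Activations may have norm exactly `M`, outside the open ball of the information bounds; hence
    -- positivity on the closed interval.
    hinfo.score_pos hM.1 hij <| (PiLp.norm_apply_le _ j).trans (hM.2 Z hZ i)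

end Smoothness

/-! ### Cluster points of the iterates. -/

section Convergence

variable {E : Type*} [NormedAddCommGroup E] [NormedSpace ℝ E]

/-- Iterates with steps of size `O(ρ)` that satisfy a summable stationarity estimate stay away
from every point of nonstationarity, provided that `∑ ρ` diverges. -/
theorem eventually_dist_ge_of_descent {L : E → ℝ} {Θ : Set E} (hc : IsCompact Θ)
    (hcont : ContinuousOn (fderiv ℝ L) Θ) {Z : ℕ → E} (hZ : ∀ k, Z k ∈ Θ) {ρ D : ℕ → ℝ} {A : ℝ}
    (hρ : ∀ k, 0 < ρ k) (hρ0 : Filter.Tendsto ρ Filter.atTop (𝓝 0)) (hρs : ¬ Summable ρ)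
    (hD0 : ∀ k, 0 ≤ D k) (hD : Summable D) (hA : 0 < A)
    (hstep : ∀ k, ‖Z (k + 1) - Z k‖ ≤ A * ρ k)
    (hest : ∀ k, ∀ Y ∈ Θ, ρ k * (-fderiv ℝ L (Z (k + 1)) (Y - Z (k + 1))) ≤
      ‖Y - Z (k + 1)‖ * D k)
    {x Y : E} (hx : x ∈ Θ) (hY : Y ∈ Θ) (hneg : fderiv ℝ L x (Y - x) < 0) :
    ∃ δ > 0, ∀ᶠ k in Filter.atTop, δ ≤ dist (Z k) x := by
  have hφ : ContinuousOn (fun z => fderiv ℝ L z (Y - z)) Θ :=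
    hcont.clm_apply (continuousOn_const.sub continuousOn_id)
  set c := -fderiv ℝ L x (Y - x) / 2 with hcdef
  have hc0 : 0 < c := by rw [hcdef]; linarith
  have hev : ∀ᶠ z in 𝓝[Θ] x, fderiv ℝ L z (Y - z) < -c :=
    (hφ x hx).eventually (gt_mem_nhds (by rw [hcdef]; linarith))
  obtain ⟨η, hη, hball⟩ := Metric.mem_nhdsWithin_iff.1 hev
  obtain ⟨d, hd⟩ := hc.bddAbove_image
    (f := fun z => ‖Y - z‖) (continuousOn_const.sub continuousOn_id).norm
  have hd' : ∀ z ∈ Θ, ‖Y - z‖ ≤ d := fun z hz => hd (Set.mem_image_of_mem _ hz)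
  have hd0 : 0 ≤ d := (norm_nonneg _).trans (hd' x hx)
  -- One third each for the distance on entry, the remaining path length, and one further step.
  set δ := η / 3 with hδ
  have hδ0 : 0 < δ := by positivity
  refine ⟨δ, hδ0, ?_⟩
  by_contra hcon
  have hfreq : ∃ᶠ k in Filter.atTop, dist (Z k) x < δ := by
    simpa only [Filter.Frequently, not_lt] using hcon
  set e : ℕ → ℝ := fun k => A * (d / c) * D k with he
  have hes : Summable e := hD.mul_left _
  have he0 : ∀ k, 0 ≤ e k := fun k => mul_nonneg (by positivity) (hD0 k)
  -- Near `x` the derivative towards `Y` is below `-c`, so the estimate becomes `c ρ ≤ d D` and step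
  -- lengths are dominated by the summable `e`.
  have hclose : ∀ k, dist (Z (k + 1)) x < η → A * ρ k ≤ e k := by
    intro k hk
    have h1 : fderiv ℝ L (Z (k + 1)) (Y - Z (k + 1)) < -c := hball ⟨hk, hZ _⟩
    have h2 := hest k Y hY
    have h3 : ρ k * c ≤ d * D k :=
      calc ρ k * c ≤ ρ k * (-fderiv ℝ L (Z (k + 1)) (Y - Z (k + 1))) :=
            mul_le_mul_of_nonneg_left (by linarith) (hρ k).le
        _ ≤ _ := h2
        _ ≤ d * D k := mul_le_mul_of_nonneg_right (hd' _ (hZ _)) (hD0 k)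
    have h4 : ρ k ≤ d / c * D k := by
      rw [div_mul_eq_mul_div, le_div_iff₀ hc0]; exact h3
    calc A * ρ k ≤ A * (d / c * D k) := by gcongr
      _ = e k := by rw [he]; ring
  have hsmall : ∀ᶠ k in Filter.atTop, ∀ m ≥ k, A * ρ m < δ := by
    have : Filter.Tendsto (fun k => A * ρ k) Filter.atTop (𝓝 0) := by
      simpa using hρ0.const_mul A
    obtain ⟨N, hN⟩ := Filter.eventually_atTop.1 (this.eventually (gt_mem_nhds hδ0))
    exact Filter.eventually_atTop.2 ⟨N, fun k hk m hm => hN m (hk.trans hm)⟩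
  have htail : ∀ᶠ k in Filter.atTop, ∑' i, e i - δ < ∑ i ∈ Finset.range k, e i :=
    hes.hasSum.tendsto_sum_nat.eventually (lt_mem_nhds (by linarith))
  obtain ⟨N, hN1, hN2, hN3⟩ := (hfreq.and_eventually (hsmall.and htail)).exists
  have hbound : ∀ m, ∑ i ∈ Finset.range m, e i - ∑ i ∈ Finset.range N, e i < δ := fun m => by
    have := hes.sum_le_tsum (Finset.range m) (fun i _ => he0 i)
    linarith
  -- Bootstrap: the crude bound `A * ρ m < δ` keeps the next iterate within `η` of `x`, and this
  -- permits replacing the step length by `e m`.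
  have hind : ∀ m, N ≤ m →
      dist (Z m) x ≤ dist (Z N) x + (∑ i ∈ Finset.range m, e i - ∑ i ∈ Finset.range N, e i) := by
    intro m hm
    induction m, hm using Nat.le_induction with
    | base => simp
    | succ m hm ih =>
      have h1 : dist (Z (m + 1)) x ≤ A * ρ m + dist (Z m) x := by
        refine (dist_triangle _ (Z m) _).trans (add_le_add_left ?_ _)
        rw [dist_eq_norm]; exact hstep m
      have h2 : A * ρ m ≤ e m := hclose m (by
        have := hbound m
        have := hN2 m hm
        linarith)
      rw [Finset.sum_range_succ]
      linarith
  refine hρs ((summable_nat_add_iff N).1 ?_)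
  have hs : Summable fun k => A⁻¹ * e (k + N) :=
    ((summable_nat_add_iff N).2 hes).mul_left _
  refine Summable.of_nonneg_of_le (fun k => (hρ _).le) (fun k => ?_) hs
  have h1 := hclose (k + N) (by
    have := hind (k + N + 1) (by omega)
    have := hbound (k + N + 1)
    linarith)
  rw [← div_eq_inv_mul, le_div_iff₀ hA, mul_comm]
  exact h1

/-- A sequence in a compact set whose cluster points lie in `S` converges to `S`. -/
theorem tendsto_infEDist_of_clusterPt {X : Type*} [PseudoMetricSpace X] {Θ S : Set X}
    (hc : IsCompact Θ) {Z : ℕ → X} (hZ : ∀ k, Z k ∈ Θ)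
    (hS : ∀ x ∈ Θ, MapClusterPt x Filter.atTop Z → x ∈ S) :
    Filter.Tendsto (fun t => Metric.infEDist (Z t) S) Filter.atTop (𝓝 0) := by
  rw [ENNReal.tendsto_nhds_zero]
  intro ε hε
  by_contra hcon
  -- A cluster point of these iterates would lie in `S` and yet at distance at least `ε` from it.
  -- The extended distance to the empty set is `⊤`, so the argument also shows that `S` is nonempty.
  have hfreq : ∃ᶠ k in Filter.atTop, Z k ∈ Θ ∩ {z | ε ≤ Metric.infEDist z S} := by
    have h1 : ∃ᶠ k in Filter.atTop, ¬ Metric.infEDist (Z k) S ≤ ε := by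
      simpa only [Filter.Frequently, not_not] using hcon
    exact h1.mono fun k hk => ⟨hZ k, (not_le.1 hk).le⟩
  have hcl : IsClosed {z | ε ≤ Metric.infEDist z S} :=
    isClosed_le continuous_const Metric.continuous_infEDist
  obtain ⟨x, hx, hcp⟩ := (hc.inter_right hcl).exists_mapClusterPt_of_frequently hfreq
  have h0 : Metric.infEDist x S = 0 := Metric.infEDist_zero_of_mem (hS x hx.1 hcp)
  exact absurd hx.2 (by simpa [h0] using hε.ne')

end Convergence

/-! ### The optimality measure in terms of the derivative. -/

section Gap

variable {E : Type*} [NormedAddCommGroup E] [InnerProductSpace ℝ E] [CompleteSpace E]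

theorem inner_gradient_eq_fderiv (f : E → ℝ) (x v : E) :
    inner ℝ (gradient f x) v = fderiv ℝ f x v :=
  InnerProductSpace.toDual_symm_apply

/-- Clears the denominator `‖y - x‖`. The point `y = x` contributes the value `0`, which is why `0 ≤
b` is required. -/
theorem optimalityMeasure_le {f : E → ℝ} {Θ : Set E} {x : E} (hx : x ∈ Θ) {b : ℝ} (hb : 0 ≤ b)
    (h : ∀ y ∈ Θ, -fderiv ℝ f x (y - x) ≤ ‖y - x‖ * b) : optimalityMeasure f Θ x ≤ b := by
  rw [optimalityMeasure, neg_le]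
  refine le_csInf (Set.Nonempty.image _ ⟨x, hx⟩) ?_
  rintro _ ⟨y, hy, rfl⟩
  simp only [inner_gradient_eq_fderiv, map_smul, smul_eq_mul]
  rcases eq_or_ne y x with rfl | hne
  · simpa using hb
  · have hpos : 0 < ‖y - x‖ := norm_pos_iff.2 (sub_ne_zero.2 hne)
    rw [← div_eq_inv_mul, le_div_iff₀ hpos]
    linarith [h y hy]

end Gap

/-! ### Partial sums of the radii `1 / (√k log k)`. -/

section Rate

/-- Lower bound for the partial sums of `1 / (√k log k)`. -/
theorem sqrt_div_log_le_sum {ρ : ℕ → ℝ} (hρ : ∀ k, 1 ≤ k → 0 < ρ k) {N T : ℕ} (hN : 2 ≤ N)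
    (hT : 2 * N ≤ T) (h : ∀ k ≥ N, ρ k = 1 / (√(k : ℝ) * Real.log (k : ℝ))) :
    √(T : ℝ) / (2 * Real.log T) ≤ ∑ k ∈ Finset.Icc 1 T, ρ k := by
  have hT1 : (1 : ℝ) < T := by exact_mod_cast (by omega : 1 < T)
  have hlog : 0 < Real.log T := Real.log_pos hT1
  have hsq : 0 < √(T : ℝ) := Real.sqrt_pos.2 (by linarith)
  have h1 : ∑ k ∈ Finset.Icc N T, ρ k ≤ ∑ k ∈ Finset.Icc 1 T, ρ k :=
    Finset.sum_le_sum_of_subset_of_nonneg (Finset.Icc_subset_Icc_left (by omega))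
      fun k hk _ => (hρ k (Finset.mem_Icc.1 hk).1).le
  -- Every term is at least the last one, and `T ≥ 2 N` leaves at least `T / 2` of them.
  have h2 : (Finset.Icc N T).card • (1 / (√(T : ℝ) * Real.log T)) ≤ ∑ k ∈ Finset.Icc N T, ρ k := by
    refine Finset.card_nsmul_le_sum _ _ _ fun k hk => ?_
    obtain ⟨hk1, hk2⟩ := Finset.mem_Icc.1 hk
    rw [h k hk1]
    have hk0 : (1 : ℝ) < k := by exact_mod_cast (by omega : 1 < k)
    have hkl : 0 < Real.log k := Real.log_pos hk0
    have hkT : (k : ℝ) ≤ T := by exact_mod_cast hk2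
    have hks : 0 < √(k : ℝ) := Real.sqrt_pos.2 (by linarith)
    have := Real.log_le_log (by linarith) hkT
    gcongr
  have h3 : (T : ℝ) / 2 ≤ ((Finset.Icc N T).card : ℝ) := by
    rw [Nat.card_Icc, Nat.cast_sub (by omega)]
    have : (2 * N : ℝ) ≤ T := by exact_mod_cast hT
    push_cast; linarith
  rw [nsmul_eq_mul] at h2
  calc √(T : ℝ) / (2 * Real.log T) = (T : ℝ) / 2 * (1 / (√(T : ℝ) * Real.log T)) := by
        have := Real.mul_self_sqrt (by linarith : (0 : ℝ) ≤ T)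
        field_simp
        linarith [sq (√(T : ℝ))]
    _ ≤ _ := mul_le_mul_of_nonneg_right h3 (by positivity)
    _ ≤ _ := h2.trans h1

/-- Logarithms are `o(√x)`. It is applied with `x` the constant `C` of the complexity bound, where
`2 * log C + 3` comes from estimating `log T`. -/
theorem eventually_log_le_sqrt (A : ℝ) :
    ∀ᶠ x : ℝ in Filter.atTop, A * (2 * (2 * Real.log x + 3)) ≤ √(x / 2) := by
  have h1 : (fun x : ℝ => A * (2 * (2 * Real.log x + 3))) =o[Filter.atTop]
      fun x : ℝ => x ^ (1 / 2 : ℝ) := by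
    have hl := isLittleO_log_rpow_atTop (r := 1 / 2) (by norm_num)
    have hk : (fun _ : ℝ => (3 : ℝ)) =o[Filter.atTop] fun x : ℝ => x ^ (1 / 2 : ℝ) :=
      Asymptotics.isLittleO_const_left.2 (Or.inr
        (Filter.tendsto_abs_atTop_atTop.comp (tendsto_rpow_atTop (by norm_num))))
    exact (((hl.const_mul_left 2).add hk).const_mul_left 2).const_mul_left A
  filter_upwards [h1.bound (show (0 : ℝ) < 1 / 2 by norm_num), Filter.eventually_ge_atTop 0]
    with x hx hx0
  rw [← Real.sqrt_eq_rpow, Real.norm_of_nonneg (Real.sqrt_nonneg x)] at hx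
  refine (le_abs_self _).trans (hx.trans ?_)
  refine Real.le_sqrt_of_sq_le ?_
  rw [mul_pow, Real.sq_sqrt hx0]
  linarith

/-- For radii `1 / (√k log k)` the reciprocal partial sums fall below `√ε` within
`O(ε⁻¹ (log ε⁻¹)²)` terms. -/
theorem exists_partial_sum_rate {ρ : ℕ → ℝ} (hρ : ∀ k, 1 ≤ k → 0 < ρ k)
    (h : ∀ᶠ k : ℕ in Filter.atTop, ρ k = 1 / (√(k : ℝ) * Real.log (k : ℝ))) {A : ℝ} (hA : 0 < A) :
    ∃ C : ℝ, 0 < C ∧ ∀ ε : ℝ, 0 < ε → ε ≤ 1 / 2 → ∃ T : ℕ, 1 ≤ T ∧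
      (T : ℝ) ≤ C * (ε⁻¹ * Real.log ε⁻¹ ^ 2) ∧ A * (∑ k ∈ Finset.Icc 1 T, ρ k)⁻¹ ≤ √ε := by
  obtain ⟨N', hN'⟩ := Filter.eventually_atTop.1 h
  set N := max N' 2 with hNdef
  have hN2 : 2 ≤ N := le_max_right _ _
  have hN : ∀ k ≥ N, ρ k = 1 / (√(k : ℝ) * Real.log (k : ℝ)) := fun k hk =>
    hN' k ((le_max_left _ _).trans hk)
  -- The second requirement gives `X ≥ 4 N` below, so that the floor `T` is at least `X / 2 ≥ 2 N`.
  obtain ⟨C, hC1, hC2⟩ := ((eventually_log_le_sqrt A).and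
    (Filter.eventually_ge_atTop (8 * N : ℝ))).exists
  have hNr : (2 : ℝ) ≤ N := by exact_mod_cast hN2
  have hC0 : 1 ≤ C := by linarith
  refine ⟨C, by linarith, fun ε hε hε2 => ?_⟩
  set u := ε⁻¹ with hu
  have hu2 : 2 ≤ u := by
    rw [hu, le_inv_comm₀ (by norm_num) hε]; linarith
  set ℓ := Real.log u with hℓ
  have hℓ1 : 0.69 < ℓ := by
    have := Real.log_le_log (by norm_num) hu2
    linarith [Real.log_two_gt_d9]
  have hX : 4 * (N : ℝ) ≤ C * (u * ℓ ^ 2) := by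
    have : 1 / 2 ≤ u * ℓ ^ 2 := by nlinarith
    nlinarith
  set X := C * (u * ℓ ^ 2) with hXdef
  have hX0 : 0 ≤ X := by linarith
  set T := ⌊X⌋₊ with hT
  have hTX : (T : ℝ) ≤ X := Nat.floor_le hX0
  have hTX' : X / 2 ≤ T := by
    have := Nat.lt_floor_add_one X
    rw [← hT] at this
    linarith
  have hTN : 2 * N ≤ T := by
    have : (2 * N : ℝ) ≤ T := by linarith
    exact_mod_cast this
  have hT1 : (1 : ℝ) < T := by exact_mod_cast (by omega : 1 < T)
  refine ⟨T, by omega, hTX, ?_⟩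
  have hsum := sqrt_div_log_le_sum hρ hN2 hTN hN
  have hlogT : 0 < Real.log T := Real.log_pos hT1
  have hlogC : 0 ≤ Real.log C := Real.log_nonneg hC0
  -- From `log X = log C + ℓ + 2 log ℓ` and `log ℓ ≤ ℓ`; since `ε ≤ 1/2` gives `ℓ > 0.69`, also `log
  -- C ≤ 2 ℓ log C`.
  have hlog : Real.log T ≤ ℓ * (2 * Real.log C + 3) := by
    have h1 : Real.log T ≤ Real.log X := Real.log_le_log (by linarith) hTX
    have h2 : Real.log X = Real.log C + (ℓ + 2 * Real.log ℓ) := by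
      rw [hXdef, Real.log_mul (by linarith) (by positivity),
        Real.log_mul (by linarith) (by positivity), Real.log_pow]
      push_cast; rfl
    have h3 : Real.log ℓ ≤ ℓ := by
      linarith [Real.log_le_sub_one_of_pos (show 0 < ℓ by linarith)]
    nlinarith
  have hsqrt : √(C / 2) * (√u * ℓ) ≤ √(T : ℝ) := by
    refine Real.le_sqrt_of_sq_le ?_
    rw [mul_pow, mul_pow, Real.sq_sqrt (by linarith), Real.sq_sqrt (by linarith)]
    rw [hXdef] at hTX'
    linarith
  -- The factor `ℓ²` in `T` gives `√T` a factor `ℓ`, which absorbs `log T`.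
  have hmain : A * √u ≤ ∑ k ∈ Finset.Icc 1 T, ρ k := by
    refine le_trans ?_ hsum
    rw [le_div_iff₀ (by positivity)]
    have hsu : 0 ≤ √u := Real.sqrt_nonneg u
    calc A * √u * (2 * Real.log T) ≤ A * √u * (2 * (ℓ * (2 * Real.log C + 3))) := by gcongr
      _ = A * (2 * (2 * Real.log C + 3)) * (√u * ℓ) := by ring
      _ ≤ √(C / 2) * (√u * ℓ) :=
        mul_le_mul_of_nonneg_right hC1 (mul_nonneg hsu (by linarith))
      _ ≤ _ := hsqrt
  have hsu : 0 < √u := Real.sqrt_pos.2 (by linarith)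
  have hpos : 0 < ∑ k ∈ Finset.Icc 1 T, ρ k := lt_of_lt_of_le (by positivity) hmain
  have hε' : √ε = (√u)⁻¹ := by rw [hu, Real.sqrt_inv, inv_inv]
  rw [hε', ← div_eq_mul_inv, div_le_iff₀ hpos, ← div_eq_inv_mul, le_div_iff₀ hsu]
  exact hmain

end Rate

/-! ### Assembly of the convergence statement and the rates. -/

/-- Convergence and rates of block coordinate descent with diminishing radius for an objective
that is twice continuously differentiable on a compact convex product set. -/
theorem convergence_of_contDiffAt {p q r n κ : ℕ}
    {Cdict : Set (FMat p r)} {Ccode : Set (FMat r n)} {Cbeta : Set (FMat r κ)}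
    {Caux : Set (FMat q κ)}
    (hdict : Convex ℝ Cdict) (hdict_compact : IsCompact Cdict)
    (hcode : Convex ℝ Ccode) (hcode_compact : IsCompact Ccode)
    (hbeta : Convex ℝ Cbeta) (hbeta_compact : IsCompact Cbeta)
    (haux : Convex ℝ Caux) (haux_compact : IsCompact Caux)
    {Θ : Set (Param p q r n κ)} (hΘ : Θ = constraintSet Cdict Ccode Cbeta Caux)
    {L : Param p q r n κ → ℝ} (hd : ∀ Z ∈ Θ, ContDiffAt ℝ 2 L Z)
    {ρ : ℕ → ℝ} (hρ_pos : ∀ k, 1 ≤ k → 0 < ρ k)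
    (hρ_sum : Filter.Tendsto (fun T : ℕ => ∑ k ∈ Finset.Icc 1 T, ρ k) Filter.atTop Filter.atTop)
    (hρ_sq : Summable fun k => ρ k ^ 2) :
    (∀ Z ∈ Θ, DifferentiableAt ℝ L Z) ∧
    (∀ Z : ℕ → Param p q r n κ, IsBCDDR L Cdict Ccode Cbeta Caux ρ Z →
      Filter.Tendsto (fun t => Metric.infEDist (Z t) {x | IsStationaryPoint L Θ x})
        Filter.atTop (𝓝 0)) ∧
    (∃ C : ℝ, 0 < C ∧
      ∀ Z : ℕ → Param p q r n κ, IsBCDDR L Cdict Ccode Cbeta Caux ρ Z →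
        ∀ (T : ℕ) (hT : 1 ≤ T),
          (Finset.Icc 1 T).inf' (Finset.nonempty_Icc.mpr hT)
              (fun k => optimalityMeasure L Θ (Z k))
            ≤ C * (∑ k ∈ Finset.Icc 1 T, ρ k)⁻¹) ∧
    ((∀ᶠ k : ℕ in Filter.atTop, ρ k = 1 / (√(k : ℝ) * Real.log (k : ℝ))) →
      ∃ C : ℝ, 0 < C ∧
        ∀ Z : ℕ → Param p q r n κ, IsBCDDR L Cdict Ccode Cbeta Caux ρ Z →
          ∀ ε : ℝ, 0 < ε → ε ≤ 1 / 2 →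
            ∃ k : ℕ, 1 ≤ k ∧ (k : ℝ) ≤ C * (ε⁻¹ * Real.log ε⁻¹ ^ 2) ∧
              IsEpsStationaryPoint L Θ ε (Z k)) := by
  have hdiff : ∀ Z ∈ Θ, DifferentiableAt ℝ L Z := fun Z hZ =>
    (hd Z hZ).differentiableAt (by norm_num)
  have hcomp : IsCompact Θ :=
    hΘ ▸ isCompact_constraintSet hdict_compact hcode_compact hbeta_compact haux_compact
  have hconv : Convex ℝ Θ := hΘ ▸ convex_constraintSet hdict hcode hbeta haux
  have hcont : ContinuousOn (fderiv ℝ L) Θ := fun Z hZ =>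
    ((hd Z hZ).fderiv_right (m := 1) (by norm_num)).continuousAt.continuousWithinAt
  obtain ⟨K, hK0, hK⟩ := exists_fderiv_lipschitz hcomp hconv hd
  -- A bound over all of `Θ` keeps the later constants independent of the starting point and of the
  -- chosen minimizers.
  obtain ⟨A, hA0, hA⟩ : ∃ A : ℝ, 0 ≤ A ∧ ∀ Z ∈ Θ, |L Z| ≤ A := by
    obtain ⟨A, hA⟩ := hcomp.bddAbove_image (f := fun Z => |L Z|)
      fun Z hZ => (hd Z hZ).continuousAt.abs.continuousWithinAt
    exact ⟨max A 0, le_max_right _ _, fun Z hZ =>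
      (hA (Set.mem_image_of_mem _ hZ)).trans (le_max_left _ _)⟩
  have hρ' : ∀ k, 0 < ρ (k + 1) := fun k => hρ_pos _ (by omega)
  have hsq' : Summable fun k => ρ (k + 1) ^ 2 := (summable_nat_add_iff 1).2 hρ_sq
  have hρ0 : Filter.Tendsto (fun k => ρ (k + 1)) Filter.atTop (𝓝 0) := by
    have := hsq'.tendsto_atTop_zero.sqrt
    simpa only [Real.sqrt_sq (hρ' _).le, Real.sqrt_zero] using this
  -- The radius `ρ (k + 1)` governs the move from `Z k` to `Z (k + 1)`, hence the shift by one
  -- throughout.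
  have hIcc : ∀ (f : ℕ → ℝ) (T : ℕ),
      ∑ k ∈ Finset.Icc 1 T, f k = ∑ k ∈ Finset.range T, f (k + 1) := fun f T => by
    rw [Finset.range_eq_Ico, Finset.sum_Ico_add' f 0 T 1, zero_add]; rfl
  have hρs : ¬ Summable fun k => ρ (k + 1) := fun hs =>
    not_tendsto_nhds_of_tendsto_atTop (hρ_sum.congr fun T => hIcc ρ T) _
      hs.hasSum.tendsto_sum_nat
  set S := ∑' k, ρ (k + 1) ^ 2 with hS
  have hS0 : 0 ≤ S := tsum_nonneg fun k => sq_nonneg _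
  set D : (ℕ → Param p q r n κ) → ℕ → ℝ := fun Z k =>
    L (Z k) - L (Z (k + 1)) + 16 * K * ρ (k + 1) ^ 2 with hD
  have hmem : ∀ Z, IsBCDDR L Cdict Ccode Cbeta Caux ρ Z → ∀ k, Z k ∈ Θ := fun Z hZ k => by
    rw [hΘ]
    cases k with
    | zero => exact hZ.init
    | succ k =>
      exact ⟨(hZ.update_W k).1.1, (hZ.update_H k).1.1, (hZ.update_B k).1.1, (hZ.update_G k).1.1⟩
  have hsweep : ∀ Z, IsBCDDR L Cdict Ccode Cbeta Caux ρ Z → ∀ k,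
      ‖Z (k + 1) - Z k‖ ≤ 4 * ρ (k + 1) ∧ 0 ≤ D Z k ∧
      ∀ Y ∈ Θ, ρ (k + 1) * (-fderiv ℝ L (Z (k + 1)) (Y - Z (k + 1))) ≤
        ‖Y - Z (k + 1)‖ * D Z k := fun Z hZ k => by
    obtain ⟨-, a, b, c⟩ := sweep_stationarity hdict hcode hbeta haux hΘ hK0 hdiff hK (hρ' k)
      (hmem Z hZ k) (hZ.update_W k) (hZ.update_B k) (hZ.update_G k) (hZ.update_H k)
    refine ⟨a, ?_, c⟩
    have : 0 ≤ 16 * K * ρ (k + 1) ^ 2 := by positivity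
    simp only [hD]; linarith
  have hDsum : ∀ Z, IsBCDDR L Cdict Ccode Cbeta Caux ρ Z → ∀ T,
      ∑ k ∈ Finset.range T, D Z k ≤ 2 * A + 16 * K * S := fun Z hZ T => by
    have h1 : ∑ k ∈ Finset.range T, ρ (k + 1) ^ 2 ≤ S :=
      hsq'.sum_le_tsum _ fun k _ => sq_nonneg _
    have h2 : 16 * K * ∑ k ∈ Finset.range T, ρ (k + 1) ^ 2 ≤ 16 * K * S := by gcongr
    simp only [hD]
    rw [Finset.sum_add_distrib, Finset.sum_range_sub', ← Finset.mul_sum]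
    linarith [le_of_abs_le (hA _ (hmem Z hZ 0)), neg_le_of_abs_le (hA _ (hmem Z hZ T))]
  -- The minimum times `∑ ρ` is at most `∑ D`. The summand `1` serves only to make the constant
  -- positive.
  have hrate : ∀ Z, IsBCDDR L Cdict Ccode Cbeta Caux ρ Z → ∀ (T : ℕ) (hT : 1 ≤ T),
      (Finset.Icc 1 T).inf' (Finset.nonempty_Icc.mpr hT) (fun k => optimalityMeasure L Θ (Z k))
        ≤ (2 * A + 16 * K * S + 1) * (∑ k ∈ Finset.Icc 1 T, ρ k)⁻¹ := by
    intro Z hZ T hT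
    set m := (Finset.Icc 1 T).inf' (Finset.nonempty_Icc.mpr hT)
      (fun k => optimalityMeasure L Θ (Z k)) with hm
    have hsum_pos : 0 < ∑ k ∈ Finset.Icc 1 T, ρ k :=
      Finset.sum_pos (fun k hk => hρ_pos k (Finset.mem_Icc.1 hk).1) (Finset.nonempty_Icc.mpr hT)
    rw [← div_eq_mul_inv, le_div_iff₀ hsum_pos, hIcc, Finset.mul_sum]
    refine (Finset.sum_le_sum fun k hk => ?_).trans ((hDsum Z hZ T).trans (by linarith))
    obtain ⟨-, b, c⟩ := hsweep Z hZ k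
    have h1 : m ≤ optimalityMeasure L Θ (Z (k + 1)) :=
      Finset.inf'_le _ (Finset.mem_Icc.2 ⟨by omega, Finset.mem_range.1 hk⟩)
    have h2 : optimalityMeasure L Θ (Z (k + 1)) ≤ D Z k / ρ (k + 1) :=
      optimalityMeasure_le (hmem Z hZ _) (div_nonneg b (hρ' k).le) fun Y hY => by
        rw [mul_div_assoc', le_div_iff₀ (hρ' k), mul_comm]
        exact c Y hY
    rw [← le_div_iff₀ (hρ' k)]
    exact h1.trans h2
  have hC0 : 0 < 2 * A + 16 * K * S + 1 := by positivity
  refine ⟨hdiff, fun Z hZ => ?_, ⟨_, hC0, hrate⟩, fun hlog => ?_⟩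
  · refine tendsto_infEDist_of_clusterPt hcomp (hmem Z hZ) fun x hx hcp => ⟨hx, fun Y hY => ?_⟩
    rw [inner_gradient_eq_fderiv]
    by_contra! hneg
    obtain ⟨δ, hδ, hev⟩ := eventually_dist_ge_of_descent hcomp hcont (hmem Z hZ) hρ' hρ0 hρs
      (fun k => (hsweep Z hZ k).2.1)
      (summable_of_sum_range_le (fun k => (hsweep Z hZ k).2.1) (hDsum Z hZ)) (by norm_num)
      (fun k => (hsweep Z hZ k).1) (fun k => (hsweep Z hZ k).2.2) hx hY hneg
    obtain ⟨k, hk1, hk2⟩ := ((hcp.frequently (Metric.ball_mem_nhds x hδ)).and_eventually hev).exists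
    exact absurd (Metric.mem_ball.1 hk1) (not_lt.2 hk2)
  -- The required iterate attains the minimum over the first `T` iterates, for a `T` at which the
  -- rate is already below `√ε`.
  · obtain ⟨C, hC, hCε⟩ := exists_partial_sum_rate hρ_pos hlog hC0
    refine ⟨C, hC, fun Z hZ ε hε hε2 => ?_⟩
    obtain ⟨T, hT1, hTC, hTε⟩ := hCε ε hε hε2
    obtain ⟨k, hk, hkeq⟩ := Finset.exists_mem_eq_inf' (Finset.nonempty_Icc.mpr hT1)
      (fun k => optimalityMeasure L Θ (Z k))
    obtain ⟨hk1, hkT⟩ := Finset.mem_Icc.1 hk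
    refine ⟨k, hk1, le_trans (by exact_mod_cast hkT) hTC, hmem Z hZ k, ?_⟩
    rw [← hkeq]
    exact (hrate Z hZ T hT1).trans hTε

end SDL

end

theorem mainTheorem3 {p q r n κ : ℕ} (model : SDL.Model) (h : ℝ → ℝ)
    (Xdata : Matrix (Fin p) (Fin n) ℝ) (Xaux : Matrix (Fin q) (Fin n) ℝ)
    (y : Fin n → Fin (κ + 1)) (ξ : ℝ) (hξ : 0 ≤ ξ)
    (Cdict : Set (SDL.FMat p r)) (Ccode : Set (SDL.FMat r n))
    (Cbeta : Set (SDL.FMat r κ)) (Caux : Set (SDL.FMat q κ))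
    (hdict : Convex ℝ Cdict) (hdict_compact : IsCompact Cdict)
    (hcode : Convex ℝ Ccode) (hcode_compact : IsCompact Ccode)
    (hbeta : Convex ℝ Cbeta) (hbeta_compact : IsCompact Cbeta)
    (haux : Convex ℝ Caux) (haux_compact : IsCompact Caux)
    (Θ : Set (SDL.Param p q r n κ)) (hΘ : Θ = SDL.constraintSet Cdict Ccode Cbeta Caux)
    (L : SDL.Param p q r n κ → ℝ) (hL : L = SDL.loss model h Xdata Xaux y ξ)
    (M : ℝ) (hM : SDL.BoundedActivation model Xdata Xaux Θ M)
    (hinfo : SDL.BoundedInformation h y M)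
    (ρ : ℕ → ℝ) (hρ_pos : ∀ k, 1 ≤ k → 0 < ρ k)
    (hρ_sum : Filter.Tendsto (fun T : ℕ => ∑ k ∈ Finset.Icc 1 T, ρ k) Filter.atTop Filter.atTop)
    (hρ_sq : Summable fun k => ρ k ^ 2) :
    (∀ Z ∈ Θ, DifferentiableAt ℝ L Z) ∧
    (∀ Z : ℕ → SDL.Param p q r n κ, SDL.IsBCDDR L Cdict Ccode Cbeta Caux ρ Z →
      Filter.Tendsto (fun t => Metric.infEDist (Z t) {x | SDL.IsStationaryPoint L Θ x})
        Filter.atTop (𝓝 0)) ∧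
    (∃ C : ℝ, 0 < C ∧
      ∀ Z : ℕ → SDL.Param p q r n κ, SDL.IsBCDDR L Cdict Ccode Cbeta Caux ρ Z →
        ∀ (T : ℕ) (hT : 1 ≤ T),
          (Finset.Icc 1 T).inf' (Finset.nonempty_Icc.mpr hT)
              (fun k => SDL.optimalityMeasure L Θ (Z k))
            ≤ C * (∑ k ∈ Finset.Icc 1 T, ρ k)⁻¹) ∧
    ((∀ᶠ k : ℕ in Filter.atTop, ρ k = 1 / (√(k : ℝ) * Real.log (k : ℝ))) →
      ∃ C : ℝ, 0 < C ∧
        ∀ Z : ℕ → SDL.Param p q r n κ, SDL.IsBCDDR L Cdict Ccode Cbeta Caux ρ Z →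
          ∀ ε : ℝ, 0 < ε → ε ≤ 1 / 2 →
            ∃ k : ℕ, 1 ≤ k ∧ (k : ℝ) ≤ C * (ε⁻¹ * Real.log ε⁻¹ ^ 2) ∧
              SDL.IsEpsStationaryPoint L Θ ε (Z k)) := by
  -- The model, the score function and the labels enter only through this smoothness statement.
  have hd : ∀ Z ∈ Θ, ContDiffAt ℝ 2 L Z := fun Z hZ =>
    hL ▸ SDL.contDiffAt_loss_of_bounded ξ hM hinfo hZ
  exact SDL.convergence_of_contDiffAt hdict hdict_compact hcode hcode_compact hbeta hbeta_compact
    haux haux_compact hΘ hd hρ_pos hρ_sum hρ_sq
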